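/- Categories are locally small; limits, colimits, (co)completeness and (co)continuity refer to small (co)limits. A directed set is a nonempty set with a directed preorder. A map $h : Q \to P$ of directed sets (not necessarily monotone) is cofinal if for every $p \in P$ there is some $q \in Q$ with $h(Q_{\geq q}) \subseteq P_{\geq p}$; a subset of $P$ is cofinal if every element of $P$ is bounded above by an element of it. Let $\mathcal{D}$ be a complete category. A (net-based) topological space object in $\mathcal{D}$ is an object $X$ with monomorphisms $\iota_P : C(P,X) \hookrightarrow X^P \times X$ for all directed sets $P$ such that the following hold. 1. (Constant nets) The diagonal $X \to X^P \times X$ factors through $C(P,X)$ for every directed set $P$. 2. (Subnets) For every cofinal map $h : Q \to P$ of directed sets, the composite of $\iota_P$ with $X^h \times \mathrm{id}_X : X^P \times X \to X^Q \times X$ factors through $C(Q,X)$. 3. (Locality) For every directed set $P$ and every family of directed sets $R_Q$ and cofinal maps $h_Q : R_Q \to Q$, indexed by the cofinal subsets $Q \subseteq P$, the projection $$\Bigl(\prod_{Q} C(R_Q,X)\Bigr) \times_{\prod_{Q} (X^{R_Q} \times X)} (X^P \times X) \to X^P \times X$$ factors through $C(P,X)$. 4. (Iterations) For every directed set $P$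 and all directed sets $Q_p$ ($p \in P$), the morphism $$\Bigl(\prod_{p \in P} C(Q_p,X)\Bigr) \times_{X^P} C(P,X) \to X^{P \times \prod_{p} Q_p} \times X$$ given on generalized elements by $\bigl(((x_{p,q})_{q \in Q_p}, s_p)_{p \in P}, ((s_p)_{p \in P}, s)\bigr) \mapsto \bigl((x_{p,f(p)})_{(p,f)}, s\bigr)$ factors through $C(P \times \prod_p Q_p, X)$. A morphism $(X,C) \to (Y,D)$ is a morphism $f : X \to Y$ in $\mathcal{D}$ such that for every directed set $P$ the composite of $\iota_P$ with $f^P \times f$ factors through $D(P,Y)$. This defines a category $\mathrm{Top}(\mathcal{D})$. For a cocomplete category $\mathcal{C}$, the category of cotopological space objects in $\mathcal{C}$ is $\mathrm{CoTop}(\mathcal{C}) := \mathrm{Top}(\mathcal{C}^{\mathrm{op}})^{\mathrm{op}}$. A cocontinuous functor $F : \mathcal{A} \to \mathcal{C}$ between cocomplete categories sends a cotopological space object $K$ in $\mathcal{A}$ to a cotopological space object $F(K)$ in $\mathcal{C}$. For a directed set $P$, let $P \cup \{\infty\}$ be the topological space in which every subset of $P$ is open and the sets $P_{\geq p} \cup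 \{\infty\}$ form a local base at $\infty$. The one-point space $1$, with the continuous maps $P \sqcup 1 \to P \cup \{\infty\}$ ($P \sqcup 1$ discrete), is a cotopological space object in $\mathrm{Top}$. **Theorem 8.4.** For every cocomplete category $\mathcal{C}$, evaluation at this cotopological space object, $F \mapsto F(1)$ with the cotopology $(P \otimes F(1)) \sqcup F(1) \cong F(P \sqcup 1) \to F(P \cup \{\infty\})$, is an equivalence of categories $$\mathrm{Hom}_{\mathrm{c}}(\mathrm{Top},\mathcal{C}) \simeq \mathrm{CoTop}(\mathcal{C}),$$ where $\mathrm{Hom}_{\mathrm{c}}(\mathrm{Top},\mathcal{C})$ is the category of cocontinuous functors $\mathrm{Top} \to \mathcal{C}$ and natural transformations. Thus $\mathrm{Top}$ is the universal cocomplete category with a cotopological space object. -/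

import Mathlib

open CategoryTheory CategoryTheory.Limits Opposite

universe u w w'

set_option linter.unusedSectionVars false

noncomputable section

/-! Directed sets and cofinal maps -/

/-- A directed set: a nonempty (small) set with a directed preorder. -/
structure DirSet : Type (u + 1) where
  carrier : Type u
  [preorder : Preorder carrier]
  [directed : IsDirectedOrder carrier]
  [nonempty : Nonempty carrier]

namespace DirSet

instance : CoeSort DirSet.{u} (Type u) := ⟨DirSet.carrier⟩

attribute [instance] DirSet.preorder DirSet.directed DirSet.nonempty

/-- A map `h : Q → P` of directed sets is cofinal if for every `p` there is some `q` such that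
`h` maps `Q_{≥ q}` into `P_{≥ p}`; it is not required to be monotone. -/
def CofinalMap {Q P : DirSet.{u}} (h : Q → P) : Prop :=
  ∀ p : P, ∃ q : Q, ∀ q' : Q, q ≤ q' → p ≤ h q'

/-- A cofinal subset of a directed set, with the induced preorder, as a directed set. -/
abbrev sub (P : DirSet.{u}) (S : Set P) (hS : IsCofinal S) : DirSet.{u} where
  carrier := S
  directed := ⟨fun a b => by
    obtain ⟨c, hac, hbc⟩ := exists_ge_ge (a : P) (b : P)
    obtain ⟨d, hd, hcd⟩ := hS c
    exact ⟨⟨d, hd⟩, hac.trans hcd, hbc.trans hcd⟩⟩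
  nonempty := by
    obtain ⟨d, hd, -⟩ := hS (Classical.arbitrary P)
    exact ⟨⟨d, hd⟩⟩

/-- The product directed set `P × ∏_{p ∈ P} Q_p`, with the product preorder. -/
abbrev iter (P : DirSet.{u}) (Q : P → DirSet.{u}) : DirSet.{u} where
  carrier := P × (∀ p : P, Q p)
  directed := ⟨fun a b => by
    obtain ⟨c, hac, hbc⟩ := exists_ge_ge a.1 b.1
    choose f hf hf' using fun p => exists_ge_ge (a.2 p) (b.2 p)
    exact ⟨⟨c, f⟩, ⟨hac, hf⟩, ⟨hbc, hf'⟩⟩⟩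
  nonempty := ⟨⟨Classical.arbitrary _, fun _ => Classical.arbitrary _⟩⟩

end DirSet

/-! The objects `X ^ P × X` -/

section NetObj

variable {D : Type w} [Category.{u} D] [HasLimits D]

/-- The object `X ^ P × X` of pairs of a `P`-indexed family in `X` and an element of `X`. -/
abbrev netObj (X : D) (P : Type u) : D := (∏ᶜ fun _ : P => X) ⨯ X

/-- The morphism `X ^ P × X ⟶ X`, `(x, s) ↦ x_p`. -/
def netPt (X : D) (P : Type u) (p : P) : netObj X P ⟶ X :=
  prod.fst ≫ Pi.π (fun _ : P => X) p

/-- The morphism `X ^ P × X ⟶ X`, `(x, s) ↦ s`. -/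
def netLim (X : D) (P : Type u) : netObj X P ⟶ X := prod.snd

/-- The morphism `T ⟶ X ^ P × X` with given components. -/
def netLift {T X : D} {P : Type u} (x : P → (T ⟶ X)) (s : T ⟶ X) : T ⟶ netObj X P :=
  prod.lift (Pi.lift x) s

/-- The morphism `X ^ h × id : X ^ P × X ⟶ X ^ Q × X`, `(x, s) ↦ (x ∘ h, s)`. -/
def netReindex (X : D) {P Q : Type u} (h : Q → P) : netObj X P ⟶ netObj X Q :=
  prod.map (Pi.lift fun q => Pi.π (fun _ : P => X) (h q)) (𝟙 X)

/-- The morphism `f ^ P × f : X ^ P × X ⟶ Y ^ P × Y`. -/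
def netMap {X Y : D} (f : X ⟶ Y) (P : Type u) : netObj X P ⟶ netObj Y P :=
  prod.map (Limits.Pi.map fun _ => f) f

theorem netObj_hom_ext {T X : D} {P : Type u} {a b : T ⟶ netObj X P}
    (h₁ : ∀ p, a ≫ netPt X P p = b ≫ netPt X P p) (h₂ : a ≫ netLim X P = b ≫ netLim X P) :
    a = b := by
  apply Limits.prod.hom_ext
  · apply Limits.Pi.hom_ext
    intro p
    simpa [netPt] using h₁ p
  · exact h₂

@[simp]
theorem netLift_netPt {T X : D} {P : Type u} (x : P → (T ⟶ X)) (s : T ⟶ X) (p : P) :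
    netLift x s ≫ netPt X P p = x p := by
  unfold netLift netPt
  rw [prod.lift_fst_assoc, Pi.lift_π]

@[simp]
theorem netLift_netPt_assoc {T X : D} {P : Type u} (x : P → (T ⟶ X)) (s : T ⟶ X) (p : P) {Z : D}
    (k : X ⟶ Z) : netLift x s ≫ netPt X P p ≫ k = x p ≫ k := by
  rw [← Category.assoc, netLift_netPt]

@[simp]
theorem netLift_netLim {T X : D} {P : Type u} (x : P → (T ⟶ X)) (s : T ⟶ X) :
    netLift x s ≫ netLim X P = s := prod.lift_snd _ _

@[simp]
theorem netLift_netLim_assoc {T X : D} {P : Type u} (x : P → (T ⟶ X)) (s : T ⟶ X) {Z : D}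
    (k : X ⟶ Z) : netLift x s ≫ netLim X P ≫ k = s ≫ k := by
  rw [← Category.assoc, netLift_netLim]

@[simp]
theorem netReindex_netPt (X : D) {P Q : Type u} (h : Q → P) (q : Q) :
    netReindex X h ≫ netPt X Q q = netPt X P (h q) := by simp [netReindex, netPt]

@[simp]
theorem netReindex_netPt_assoc (X : D) {P Q : Type u} (h : Q → P) (q : Q) {Z : D}
    (k : X ⟶ Z) : netReindex X h ≫ netPt X Q q ≫ k = netPt X P (h q) ≫ k := by
  rw [← Category.assoc, netReindex_netPt]

@[simp]
theorem netReindex_netLim (X : D) {P Q : Type u} (h : Q → P) :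
    netReindex X h ≫ netLim X Q = netLim X P := by
  simp [netReindex, netLim]

@[simp]
theorem netReindex_netLim_assoc (X : D) {P Q : Type u} (h : Q → P) {Z : D}
    (k : X ⟶ Z) : netReindex X h ≫ netLim X Q ≫ k = netLim X P ≫ k := by
  rw [← Category.assoc, netReindex_netLim]

@[simp]
theorem netMap_netPt {X Y : D} (f : X ⟶ Y) (P : Type u) (p : P) :
    netMap f P ≫ netPt Y P p = netPt X P p ≫ f := by simp [netMap, netPt]

@[simp]
theorem netMap_netPt_assoc {X Y : D} (f : X ⟶ Y) (P : Type u) (p : P) {Z : D}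
    (k : Y ⟶ Z) : netMap f P ≫ netPt Y P p ≫ k = netPt X P p ≫ f ≫ k := by
  rw [← Category.assoc, netMap_netPt, Category.assoc]

@[simp]
theorem netMap_netLim {X Y : D} (f : X ⟶ Y) (P : Type u) :
    netMap f P ≫ netLim Y P = netLim X P ≫ f := by
  simp [netMap, netLim]

@[simp]
theorem netMap_netLim_assoc {X Y : D} (f : X ⟶ Y) (P : Type u) {Z : D}
    (k : Y ⟶ Z) : netMap f P ≫ netLim Y P ≫ k = netLim X P ≫ f ≫ k := by
  rw [← Category.assoc, netMap_netLim, Category.assoc]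

theorem netObj_condition {X T B : D} {P : Type u} {Q : P → Type u} {E : P → D}
    (a : ∀ p, E p ⟶ netObj X (Q p)) (b : B ⟶ netObj X P) {pf : T ⟶ ∏ᶜ E} {ps : T ⟶ B}
    (h : pf ≫ (Limits.Pi.map fun p => a p ≫ netLim X (Q p)) = ps ≫ b ≫ prod.fst) (p : P) :
    pf ≫ Pi.π E p ≫ a p ≫ netLim X (Q p) = ps ≫ b ≫ netPt X P p := by
  have h' := h =≫ Pi.π (fun _ : P => X) p
  rw [Category.assoc, Limits.Pi.map_π] at h'
  simpa only [netPt, Category.assoc] using h'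

end NetObj

/-! Topological space objects -/


/-- A (net-based) topological space object in a complete category `D`: an object `X` with
monomorphisms `ι : C(P, X) ⟶ X ^ P × X`, one for each directed set `P`, satisfying the four
axioms of a net convergence relation. -/
structure TopObj (D : Type w) [Category.{u} D] [HasLimits D] where
  /-- the underlying object -/
  X : D
  /-- the object of convergent `P`-indexed nets (together with a limit) -/
  C : DirSet.{u} → D
  ι : ∀ P : DirSet.{u}, C P ⟶ netObj X P
  mono : ∀ P, Mono (ι P)
  /-- Constant nets: the diagonal `X ⟶ X ^ P × X` factors through `C(P, X)`. -/
  const : ∀ P : DirSet.{u}, ∃ c : X ⟶ C P, c ≫ ι P = netLift (fun _ => 𝟙 X) (𝟙 X)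
  /-- Subnets. -/
  subnet : ∀ (P Q : DirSet.{u}) (h : Q → P), DirSet.CofinalMap h →
    ∃ c : C P ⟶ C Q, c ≫ ι Q = ι P ≫ netReindex X h
  /-- Locality: for cofinal maps `h S : R S ⟶ S`, where `S` runs through the cofinal subsets of
  `P`, the second projection of the fiber product
  `(∏_S C(R_S, X)) ×_{∏_S (X ^ R_S × X)} (X ^ P × X)` factors through `C(P, X)`. -/
  loc : ∀ (P : DirSet.{u}) (R : {S : Set P // IsCofinal S} → DirSet.{u})
    (h : ∀ S : {S : Set P // IsCofinal S}, R S → P.sub S.1 S.2),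
    (∀ S, DirSet.CofinalMap (h S)) →
    ∃ c : pullback (Limits.Pi.map fun S => ι (R S))
        (Pi.lift fun S => netReindex X fun r : R S => (h S r).1) ⟶ C P,
      c ≫ ι P = pullback.snd _ _
  /-- Iterations: on the fiber product `(∏_p C(Q_p, X)) ×_{X ^ P} C(P, X)`, the morphism
  `((x_{p,q})_q ⟶ s_p)_p, ((s_p)_p ⟶ s) ↦ ((x_{p,f(p)})_{(p,f)}, s)` factors through
  `C(P × ∏_p Q_p, X)`. -/
  iter : ∀ (P : DirSet.{u}) (Q : P → DirSet.{u}),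
    ∃ c : pullback (Limits.Pi.map fun p => ι (Q p) ≫ netLim X (Q p)) (ι P ≫ prod.fst) ⟶
        C (P.iter Q),
      c ≫ ι (P.iter Q) =
        netLift
          (fun z : P.iter Q =>
            pullback.fst _ _ ≫ Pi.π _ z.1 ≫ ι (Q z.1) ≫ netPt X (Q z.1) (z.2 z.1))
          (pullback.snd _ _ ≫ ι P ≫ netLim X P)

namespace TopObj

variable {D : Type w} [Category.{u} D] [HasLimits D]

attribute [instance] TopObj.mono

/-- A morphism of topological space objects: a morphism of the underlying objects that
preserves net convergence. -/
@[ext]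
structure Hom (A B : TopObj D) where
  f : A.X ⟶ B.X
  cont : ∀ P : DirSet.{u}, ∃ g : A.C P ⟶ B.C P, g ≫ B.ι P = A.ι P ≫ netMap f P

instance : Category.{u} (TopObj D) where
  Hom := Hom
  id A := ⟨𝟙 A.X, fun P => ⟨𝟙 _, by
    rw [Category.id_comp]
    conv_lhs => rw [← Category.comp_id (A.ι P)]
    congr 1
    apply netObj_hom_ext <;> simp⟩⟩
  comp {A B E} f g := ⟨f.f ≫ g.f, fun P => by
    obtain ⟨a, ha⟩ := f.cont P
    obtain ⟨b, hb⟩ := g.cont P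
    refine ⟨a ≫ b, ?_⟩
    rw [Category.assoc, hb, reassoc_of% ha]
    congr 1
    apply netObj_hom_ext <;> simp⟩
  id_comp f := Hom.ext (Category.id_comp f.f)
  comp_id f := Hom.ext (Category.comp_id f.f)
  assoc f g h := Hom.ext (Category.assoc f.f g.f h.f)

@[simp] theorem id_f (A : TopObj D) : Hom.f (𝟙 A) = 𝟙 A.X := rfl

@[simp] theorem comp_f {A B E : TopObj D} (f : A ⟶ B) (g : B ⟶ E) :
    Hom.f (f ≫ g) = f.f ≫ g.f := rfl

theorem hom_ext {A B : TopObj D} {f g : A ⟶ B} (h : f.f = g.f) : f = g := Hom.ext h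

/-! Transport along continuous functors -/

section Map

variable {D' : Type w'} [Category.{u} D'] [HasLimits D']
  (G : D ⥤ D') [PreservesLimitsOfSize.{u, u} G]

/-- The canonical morphism `G (X ^ P × X) ⟶ (G X) ^ P × G X`. -/
abbrev netComparison (X : D) (P : Type u) : G.obj (netObj X P) ⟶ netObj (G.obj X) P :=
  netLift (fun p => G.map (netPt X P p)) (G.map (netLim X P))

instance isIso_netComparison (X : D) (P : Type u) : IsIso (netComparison G X P) := by
  have : netComparison G X P =
      prodComparison G (∏ᶜ fun _ : P => X) X ≫
        prod.map (piComparison G fun _ : P => X) (𝟙 _) := by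
    apply netObj_hom_ext
    · intro p
      rw [netLift_netPt]
      unfold netPt prodComparison
      rw [Category.assoc, prod.map_fst_assoc, prod.lift_fst_assoc, piComparison_comp_π,
        G.map_comp]
    · rw [netLift_netLim]
      unfold netLim prodComparison
      rw [Category.assoc, prod.map_snd, Category.comp_id, prod.lift_snd]
  rw [this]
  infer_instance

theorem netComparison_reindex (X : D) {P Q : Type u} (h : Q → P) :
    G.map (netReindex X h) ≫ netComparison G X Q =
      netComparison G X P ≫ netReindex (G.obj X) h := by
  apply netObj_hom_ext
  · intro q
    rw [Category.assoc, Category.assoc, netLift_netPt, netReindex_netPt, netLift_netPt,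
      ← G.map_comp, netReindex_netPt]
  · rw [Category.assoc, Category.assoc, netLift_netLim, netReindex_netLim, netLift_netLim,
      ← G.map_comp, netReindex_netLim]

theorem netComparison_map {X Y : D} (f : X ⟶ Y) (P : Type u) :
    G.map (netMap f P) ≫ netComparison G Y P = netComparison G X P ≫ netMap (G.map f) P := by
  apply netObj_hom_ext
  · intro p
    rw [Category.assoc, Category.assoc, netLift_netPt, netMap_netPt, netLift_netPt_assoc,
      ← G.map_comp, netMap_netPt, G.map_comp]
  · rw [Category.assoc, Category.assoc, netLift_netLim, netMap_netLim, netLift_netLim_assoc,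
      ← G.map_comp, netMap_netLim, G.map_comp]

theorem exists_pullbackLift {A B E : D} (f : A ⟶ E) (g : B ⟶ E) {T : D'} (a : T ⟶ G.obj A)
    (b : T ⟶ G.obj B) (h : a ≫ G.map f = b ≫ G.map g) :
    ∃ l : T ⟶ G.obj (pullback f g), l ≫ G.map (pullback.fst f g) = a ∧
      l ≫ G.map (pullback.snd f g) = b :=
  let hl := isLimitOfHasPullbackOfPreservesLimit G f g
  ⟨PullbackCone.IsLimit.lift hl a b h, PullbackCone.IsLimit.lift_fst hl a b h,
    PullbackCone.IsLimit.lift_snd hl a b h⟩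

theorem exists_piLift {J : Type u} (f : J → D) {T : D'} (a : ∀ j, T ⟶ G.obj (f j)) :
    ∃ l : T ⟶ G.obj (∏ᶜ f), ∀ j, l ≫ G.map (Pi.π f j) = a j :=
  ⟨Pi.lift a ≫ inv (piComparison G f), fun j => by simp⟩

theorem map_pi_hom_ext {J : Type u} (f : J → D) {T : D'} {a b : T ⟶ G.obj (∏ᶜ f)}
    (h : ∀ j, a ≫ G.map (Pi.π f j) = b ≫ G.map (Pi.π f j)) : a = b := by
  rw [← cancel_mono (piComparison G f)]
  apply Limits.Pi.hom_ext
  intro j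
  simpa using h j

theorem exists_loc (A : TopObj D) (P : DirSet.{u})
    (R : {S : Set P // IsCofinal S} → DirSet.{u})
    (h : ∀ S : {S : Set P // IsCofinal S}, R S → P.sub S.1 S.2)
    (hh : ∀ S, DirSet.CofinalMap (h S)) {T : D'} (pf : T ⟶ ∏ᶜ fun S => G.obj (A.C (R S)))
    (ps : T ⟶ netObj (G.obj A.X) P)
    (hcond : ∀ S, pf ≫ Pi.π _ S ≫ G.map (A.ι (R S)) ≫ netComparison G A.X (R S) =
        ps ≫ netReindex (G.obj A.X) fun r : R S => (h S r).1) :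
    ∃ c : T ⟶ G.obj (A.C P), c ≫ G.map (A.ι P) ≫ netComparison G A.X P = ps := by
  obtain ⟨c, hc⟩ := A.loc P R h hh
  obtain ⟨a, ha⟩ := exists_piLift G (fun S => A.C (R S)) (fun S => pf ≫ Pi.π _ S)
  obtain ⟨l, -, hl⟩ := exists_pullbackLift G (Limits.Pi.map fun S => A.ι (R S))
    (Pi.lift fun S => netReindex A.X fun r : R S => (h S r).1) a
    (ps ≫ inv (netComparison G A.X P)) (by
      apply map_pi_hom_ext
      intro S
      rw [Category.assoc, Category.assoc, Category.assoc, ← G.map_comp, ← G.map_comp,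
        Pi.lift_π, Limits.Pi.map_π, G.map_comp, reassoc_of% ha,
        ← cancel_mono (netComparison G A.X (R S))]
      simp only [Category.assoc]
      rw [hcond, netComparison_reindex, IsIso.inv_hom_id_assoc])
  refine ⟨l ≫ G.map c, ?_⟩
  rw [Category.assoc, ← G.map_comp_assoc, hc, reassoc_of% hl, IsIso.inv_hom_id,
    Category.comp_id]

theorem exists_iter (A : TopObj D) (P : DirSet.{u}) (Q : P → DirSet.{u}) {T : D'}
    (pf : T ⟶ ∏ᶜ fun p => G.obj (A.C (Q p))) (ps : T ⟶ G.obj (A.C P))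
    (hcond' : ∀ p, pf ≫ Pi.π _ p ≫ (G.map (A.ι (Q p)) ≫ netComparison G A.X (Q p)) ≫
        netLim (G.obj A.X) (Q p) =
      ps ≫ (G.map (A.ι P) ≫ netComparison G A.X P) ≫ netPt (G.obj A.X) P p) :
    ∃ c : T ⟶ G.obj (A.C (P.iter Q)),
      c ≫ G.map (A.ι (P.iter Q)) ≫ netComparison G A.X (P.iter Q) =
        netLift
          (fun z : P.iter Q =>
            pf ≫ Pi.π _ z.1 ≫ (G.map (A.ι (Q z.1)) ≫ netComparison G A.X (Q z.1)) ≫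
              netPt (G.obj A.X) (Q z.1) (z.2 z.1))
          (ps ≫ (G.map (A.ι P) ≫ netComparison G A.X P) ≫ netLim (G.obj A.X) P) := by
  obtain ⟨c, hc⟩ := A.iter P Q
  have hcond : ∀ p, pf ≫ Pi.π _ p ≫ G.map (A.ι (Q p) ≫ netLim A.X (Q p)) =
      ps ≫ G.map (A.ι P ≫ netPt A.X P p) := by
    intro p
    have := hcond' p
    rwa [Category.assoc, Category.assoc, netLift_netLim, netLift_netPt, ← G.map_comp,
      ← G.map_comp] at this
  obtain ⟨a, ha⟩ := exists_piLift G (fun p => A.C (Q p)) (fun p => pf ≫ Pi.π _ p)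
  obtain ⟨l, hl₁, hl₂⟩ := exists_pullbackLift G
    (Limits.Pi.map fun p => A.ι (Q p) ≫ netLim A.X (Q p)) (A.ι P ≫ prod.fst) a ps (by
      apply map_pi_hom_ext
      intro p
      rw [Category.assoc, Category.assoc, ← G.map_comp, ← G.map_comp, Limits.Pi.map_π,
        G.map_comp, reassoc_of% ha, hcond, Category.assoc]
      rfl)
  refine ⟨l ≫ G.map c, ?_⟩
  rw [Category.assoc, ← G.map_comp_assoc, hc]
  apply netObj_hom_ext
  · rintro ⟨p, f⟩
    rw [Category.assoc, Category.assoc, netLift_netPt, netLift_netPt, ← G.map_comp,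
      netLift_netPt, G.map_comp, reassoc_of% hl₁, G.map_comp, reassoc_of% ha, Category.assoc,
      netLift_netPt, G.map_comp]
  · rw [Category.assoc, Category.assoc, netLift_netLim, netLift_netLim, ← G.map_comp,
      netLift_netLim, G.map_comp, reassoc_of% hl₂, Category.assoc,
      netLift_netLim, G.map_comp]

/-- The image of a topological space object under a continuous functor: the underlying object is
`G X`, with `G (C(P, X)) ⟶ G (X ^ P × X) ≅ (G X) ^ P × G X`. -/
def mapObj (A : TopObj D) : TopObj D' where
  X := G.obj A.X
  C P := G.obj (A.C P)
  ι P := G.map (A.ι P) ≫ netComparison G A.X P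
  mono P := inferInstance
  const P := by
    obtain ⟨c, hc⟩ := A.const P
    refine ⟨G.map c, ?_⟩
    rw [← Category.assoc, ← G.map_comp, hc]
    apply netObj_hom_ext
    · intro p
      rw [Category.assoc, netLift_netPt, netLift_netPt, ← G.map_comp, netLift_netPt, G.map_id]
    · rw [Category.assoc, netLift_netLim, netLift_netLim, ← G.map_comp, netLift_netLim, G.map_id]
  subnet P Q h hh := by
    obtain ⟨c, hc⟩ := A.subnet P Q h hh
    refine ⟨G.map c, ?_⟩
    rw [← Category.assoc, ← G.map_comp, hc, G.map_comp, Category.assoc, Category.assoc,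
      netComparison_reindex]
  loc P R h hh := by
    obtain ⟨c, hc⟩ := exists_loc G A P R h hh (pullback.fst _ _) (pullback.snd _ _) fun S => by
      have := pullback.condition
        (f := Limits.Pi.map fun S => G.map (A.ι (R S)) ≫ netComparison G A.X (R S))
        (g := Pi.lift fun S => netReindex (G.obj A.X) fun r : R S => (h S r).1) =≫ Pi.π _ S
      simpa using this
    exact ⟨c, hc⟩
  iter P Q := by
    refine exists_iter G A P Q (pullback.fst _ _) (pullback.snd _ _) fun p => ?_
    exact netObj_condition (fun p => G.map (A.ι (Q p)) ≫ netComparison G A.X (Q p))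
      (G.map (A.ι P) ≫ netComparison G A.X P) pullback.condition p

/-- A continuous functor induces a functor between the categories of topological space objects. -/
def map : TopObj D ⥤ TopObj D' where
  obj A := mapObj G A
  map {A B} f := ⟨G.map f.f, fun P => by
    obtain ⟨g, hg⟩ := f.cont P
    refine ⟨G.map g, ?_⟩
    change G.map g ≫ G.map (B.ι P) ≫ netComparison G B.X P =
      (G.map (A.ι P) ≫ netComparison G A.X P) ≫ netMap (G.map f.f) P
    rw [← G.map_comp_assoc, hg, G.map_comp, Category.assoc, Category.assoc, netComparison_map]⟩
  map_id A := hom_ext (G.map_id A.X)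
  map_comp f g := hom_ext (G.map_comp f.f g.f)

/-- A natural transformation between continuous functors induces a morphism between the images of
a topological space object. -/
def mapHom {G H : D ⥤ D'} [PreservesLimitsOfSize.{u, u} G] [PreservesLimitsOfSize.{u, u} H]
    (α : G ⟶ H) (A : TopObj D) : mapObj G A ⟶ mapObj H A :=
  ⟨α.app A.X, fun P => ⟨α.app (A.C P), by
    change α.app (A.C P) ≫ H.map (A.ι P) ≫ netComparison H A.X P =
      (G.map (A.ι P) ≫ netComparison G A.X P) ≫ netMap (α.app A.X) P
    rw [← α.naturality_assoc, Category.assoc]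
    congr 1
    apply netObj_hom_ext
    · intro p
      rw [Category.assoc, Category.assoc, netLift_netPt, netMap_netPt, netLift_netPt_assoc,
        α.naturality]
    · rw [Category.assoc, Category.assoc, netLift_netLim, netMap_netLim, netLift_netLim_assoc,
        α.naturality]⟩⟩

end Map
end TopObj

/-! Cotopological space objects -/

/-- The category `Top(Cᵒᵖ)ᵒᵖ` of cotopological space objects in a cocomplete category `C`. -/
abbrev CoTop (C : Type w) [Category.{u} C] [HasColimits C] := (TopObj Cᵒᵖ)ᵒᵖ

/-- The category of cocontinuous functors (i.e. functors preserving small colimits). -/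
abbrev CocontFunctor (A : Type w) [Category.{u} A] (C : Type w') [Category.{u} C] :=
  ObjectProperty.FullSubcategory fun F : A ⥤ C => PreservesColimitsOfSize.{u, u} F

namespace CoTop

variable {A : Type w} [Category.{u} A] [HasColimits A]
  {C : Type w'} [Category.{u} C] [HasColimits C]

instance preservesLimits_op_obj (F : CocontFunctor A C) :
    PreservesLimitsOfSize.{u, u} F.obj.op :=
  have := F.property
  preservesLimitsOfSize_op F.obj

/-- The image of a cotopological space object under a cocontinuous functor. -/
def map (F : CocontFunctor A C) : CoTop A ⥤ CoTop C :=
  (TopObj.map F.obj.op).op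

/-- For a cotopological space object `K` in `A`, the functor `F ↦ F(K)` from cocontinuous functors
`A ⥤ C` to cotopological space objects in `C`. -/
def evalAt (K : CoTop A) : CocontFunctor A C ⥤ CoTop C where
  obj F := (map F).obj K
  map {F G} α := (TopObj.mapHom (G := G.obj.op) (H := F.obj.op) (NatTrans.op α.hom) K.unop).op
  map_id _ := rfl
  map_comp _ _ := rfl

end CoTop

/-! The universal cotopological space object -/

/-- The set `P ∪ {∞}`, where `∞` is `none`. -/
def ConvSpace (P : DirSet.{u}) : Type u := Option P

namespace ConvSpace

/-- The topology on `P ∪ {∞}`: every subset of `P` is open, and the sets `P_{≥ p} ∪ {∞}` form a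
local base at `∞`. -/
instance (P : DirSet.{u}) : TopologicalSpace (ConvSpace P) where
  IsOpen U := (none : Option P) ∈ U → ∃ p : P, ∀ q : P, p ≤ q → (some q : Option P) ∈ U
  isOpen_univ _ := ⟨Classical.arbitrary P, fun _ _ => trivial⟩
  isOpen_inter U V hU hV h := by
    obtain ⟨p, hp⟩ := hU h.1
    obtain ⟨q, hq⟩ := hV h.2
    obtain ⟨r, hpr, hqr⟩ := exists_ge_ge p q
    exact ⟨r, fun t ht => ⟨hp t (hpr.trans ht), hq t (hqr.trans ht)⟩⟩
  isOpen_sUnion 𝒰 h𝒰 h := by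
    obtain ⟨U, hU, hU'⟩ := h
    obtain ⟨p, hp⟩ := h𝒰 U hU hU'
    exact ⟨p, fun q hq => ⟨U, hU, hp q hq⟩⟩

variable {P : DirSet.{u}}

/-- The point `p` of `P ∪ {∞}`. -/
def pt (p : P) : ConvSpace P := some p

/-- The point `∞` of `P ∪ {∞}`. -/
def infty : ConvSpace P := none

theorem isOpen_iff {U : Set (ConvSpace P)} :
    IsOpen U ↔ (infty ∈ U → ∃ p : P, ∀ q : P, p ≤ q → pt q ∈ U) := Iff.rfl

/-- The map on `P ∪ {∞}` given by a family and a further element. -/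
def extend {M : Type u} (x : P → M) (s : M) : ConvSpace P → M
  | none => s
  | some p => x p

/-- Net convergence in a topological space. -/
def Converges {M : Type u} [TopologicalSpace M] (x : P → M) (s : M) : Prop :=
  ∀ U : Set M, IsOpen U → s ∈ U → ∃ p : P, ∀ q : P, p ≤ q → x q ∈ U

theorem continuous_extend_iff {M : Type u} [TopologicalSpace M] {x : P → M} {s : M} :
    Continuous (extend x s) ↔ Converges x s := by
  rw [continuous_def]
  rfl

theorem converges_of_continuous {M : Type u} [TopologicalSpace M] {f : ConvSpace P → M}
    (hf : Continuous f) : Converges (fun p => f (pt p)) (f infty) :=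
  fun _ hU hs => hU.preimage hf hs

end ConvSpace

namespace PointCoTop

open ConvSpace

/-- The one-point space. -/
abbrev point : TopCat.{u} := TopCat.of PUnit.{u + 1}

/-- A point `m` of a space `M`, as a continuous map `1 ⟶ M`. -/
def ptHom {M : TopCat.{u}} (m : M) : point ⟶ M := TopCat.ofHom (ContinuousMap.const _ m)

/-- The point of `M` given by a continuous map `1 ⟶ M`. -/
def ev {T : TopCat.{u}ᵒᵖ} (t : T ⟶ op point.{u}) : T.unop := t.unop PUnit.unit

theorem ev_injective {T : TopCat.{u}ᵒᵖ} {t t' : T ⟶ op point.{u}} (h : ev t = ev t') : t = t' := by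
  apply Quiver.Hom.unop_inj
  ext z
  exact h

/-- The comparison `P ⊔ 1 ⟶ P ∪ {∞}`, as a morphism `P ∪ {∞} ⟶ 1 ^ P × 1` in the opposite of the
category of topological spaces. -/
def incl (P : DirSet.{u}) :
    op (TopCat.of (ConvSpace P)) ⟶ netObj (op point.{u}) P :=
  netLift (fun p => (ptHom (M := TopCat.of (ConvSpace P)) (pt p)).op)
    (ptHom (M := TopCat.of (ConvSpace P)) infty).op

theorem ev_comp_incl_netPt {T : TopCat.{u}ᵒᵖ} {P : DirSet.{u}}
    (c : T ⟶ op (TopCat.of (ConvSpace P))) (p : P) :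
    ev (c ≫ incl P ≫ netPt _ P p) = c.unop (pt p) := by
  rw [incl, netLift_netPt]
  rfl

theorem ev_comp_incl_netLim {T : TopCat.{u}ᵒᵖ} {P : DirSet.{u}}
    (c : T ⟶ op (TopCat.of (ConvSpace P))) :
    ev (c ≫ incl P ≫ netLim _ P) = c.unop infty := by
  rw [incl, netLift_netLim]
  rfl

instance (P : DirSet.{u}) : Mono (incl P) where
  right_cancellation {T} g h hgh := by
    apply Quiver.Hom.unop_inj
    apply TopCat.hom_ext
    apply ContinuousMap.ext
    rintro (_ | p)
    · change g.unop infty = h.unop infty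
      rw [← ev_comp_incl_netLim, ← ev_comp_incl_netLim, reassoc_of% hgh]
    · change g.unop (pt p) = h.unop (pt p)
      rw [← ev_comp_incl_netPt, ← ev_comp_incl_netPt, reassoc_of% hgh]

theorem converges {T : TopCat.{u}ᵒᵖ} {P : DirSet.{u}} (c : T ⟶ op (TopCat.of (ConvSpace P))) :
    Converges (fun p => ev (c ≫ incl P ≫ netPt _ P p)) (ev (c ≫ incl P ≫ netLim _ P)) := by
  simp only [ev_comp_incl_netPt, ev_comp_incl_netLim]
  exact converges_of_continuous c.unop.hom.continuous

theorem exists_factor {T : TopCat.{u}ᵒᵖ} {P : DirSet.{u}} (t : T ⟶ netObj (op point.{u}) P)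
    (h : Converges (fun p => ev (t ≫ netPt _ P p)) (ev (t ≫ netLim _ P))) :
    ∃ c : T ⟶ op (TopCat.of (ConvSpace P)), c ≫ incl P = t := by
  refine ⟨(TopCat.ofHom ⟨_, continuous_extend_iff.2 h⟩ : TopCat.of (ConvSpace P) ⟶ T.unop).op, ?_⟩
  apply netObj_hom_ext
  · intro p
    apply ev_injective
    rw [Category.assoc, ev_comp_incl_netPt]
    rfl
  · apply ev_injective
    rw [Category.assoc, ev_comp_incl_netLim]
    rfl

end PointCoTop

open PointCoTop ConvSpace in
/-- The cotopological space object in the category of topological spaces given by the one-point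
space with `P ⊔ 1 ⟶ P ∪ {∞}`. -/
def pointCoTop : CoTop TopCat.{u} := op {
  X := op point
  C P := op (TopCat.of (ConvSpace P))
  ι P := incl P
  mono P := inferInstance
  const P := by
    apply exists_factor
    intro U _ hs
    refine ⟨Classical.arbitrary P, fun q _ => ?_⟩
    simpa using hs
  subnet P Q h hh := by
    apply exists_factor
    have := converges (𝟙 (op (TopCat.of (ConvSpace P))))
    simp only [Category.id_comp] at this
    simp only [Category.assoc, netReindex_netPt, netReindex_netLim]
    intro U hU hs
    obtain ⟨p, hp⟩ := this U hU hs
    obtain ⟨q, hq⟩ := hh p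
    exact ⟨q, fun q' hq' => hp _ (hq q' hq')⟩
  loc P R h hh := by
    apply exists_factor
    set f := Limits.Pi.map fun S => incl (R S)
    set g := Pi.lift fun S => netReindex (op point.{u}) fun r : R S => (h S r).1
    intro U hU hs
    by_contra hcon
    push Not at hcon
    let S : {S : Set P // IsCofinal S} :=
      ⟨{q | ev (pullback.snd f g ≫ netPt _ P q) ∉ U}, fun p => by
        obtain ⟨q, hpq, hq⟩ := hcon p
        exact ⟨q, hq, hpq⟩⟩
    have key : pullback.fst f g ≫ Pi.π _ S ≫ incl (R S) =
        pullback.snd f g ≫ netReindex (op point.{u}) fun r : R S => (h S r).1 := by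
      simpa [f, g] using pullback.condition (f := f) (g := g) =≫ Pi.π _ S
    have hc := converges (pullback.fst f g ≫ Pi.π _ S)
    simp only [Category.assoc, reassoc_of% key, netReindex_netPt, netReindex_netLim] at hc
    obtain ⟨r, hr⟩ := hc U hU hs
    exact (h S r).2 (hr r le_rfl)
  iter P Q := by
    apply exists_factor
    set f := Limits.Pi.map fun p => incl (Q p) ≫ netLim (op point.{u}) (Q p)
    set b := incl P
    have key : ∀ p, pullback.fst f (b ≫ prod.fst) ≫ Pi.π _ p ≫ incl (Q p) ≫ netLim _ (Q p) =
        pullback.snd f (b ≫ prod.fst) ≫ b ≫ netPt _ P p :=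
      netObj_condition (fun p => incl (Q p)) b pullback.condition
    have hP := converges (pullback.snd f (b ≫ prod.fst))
    have hQ := fun p => converges (pullback.fst f (b ≫ prod.fst) ≫ Pi.π _ p)
    simp only [netLift_netPt, netLift_netLim]
    simp only [Category.assoc, key] at hQ
    intro U hU hs
    obtain ⟨p₀, hp₀⟩ := hP U hU hs
    choose F hF using fun p : {p : P // p₀ ≤ p} => hQ p.1 U hU (hp₀ p.1 p.2)
    classical
    refine ⟨⟨p₀, fun p => if hp : p₀ ≤ p then F ⟨p, hp⟩ else Classical.arbitrary _⟩, ?_⟩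
    rintro ⟨p, k⟩ ⟨hp, hk⟩
    have hk' := hk p
    simp only [] at hp hk'
    rw [dif_pos hp] at hk'
    exact hF ⟨p, hp⟩ (k p) hk' }

end

/-! The proof rests on Kelley's characterization of topologies by net convergence. For a topological
space object `A` in a complete category `D` and an object `T` of `D`, the axioms of `A` say that the
`T`-valued points `T ⟶ A.X` carry a convergence relation for nets satisfying Kelley's axioms, so it
is the convergence of a topology (`ConvClass.converges_iff`). Hence a cotopological space object `K`
in `C` makes `Hom(K, -)` a functor from `C` to topological spaces.

A map out of a space `M` is continuous as soon as it preserves the convergence of the neighbourhood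
net `(U, x) ↦ x` of each point (`continuous_of_converges_nhdNet`). Since these nets form a small set,
the continuous maps `M → Hom(K, Y)` are represented by a small colimit in `C` of copies of `K` and
of its objects of convergent nets (`TopObj.powEquiv`, formulated dually). So `Hom(K, -)` has a left
adjoint. This is a cocontinuous functor, and its value at the point is `K` (`CoTop.tensorPointIso`),
because the point represents the underlying set and `P ∪ {∞}` represents the convergent `P`-nets.
This gives essential surjectivity.

By the same criterion, `M` is itself a small colimit of points and spaces `P ∪ {∞}`
(`PointCoTop.isPushout_nhdHom`). A cocontinuous functor `F` preserves this colimit, and therefore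
morphisms `F(M) ⟶ Y` are the same as families of morphisms `F(1) ⟶ Y` that depend continuously on the
point of `M` (`CoTop.exists_map_ptHom_comp`, `CoTop.map_ptHom_hom_ext`). Applied to `Y = G(M)`, this
shows that a natural transformation `F ⟶ G` is the same as a morphism `F(1) ⟶ G(1)` of cotopological
space objects. -/

noncomputable section

/-! ### Convergence classes and their topologies -/

/-- A convergence class on a set `S`: a relation between nets in `S`, indexed by arbitrary directed
sets, and elements of `S`, subject to Kelley's four axioms. -/
structure ConvClass (S : Type u) where
  /-- the net `x` converges to `s` -/
  Conv : ∀ {P : DirSet.{u}}, (P → S) → S → Prop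
  const : ∀ (P : DirSet.{u}) (s : S), Conv (fun _ : P => s) s
  subnet : ∀ {P Q : DirSet.{u}} (h : Q → P), DirSet.CofinalMap h →
    ∀ {x : P → S} {s : S}, Conv x s → Conv (fun q => x (h q)) s
  loc : ∀ {P : DirSet.{u}} {x : P → S} {s : S},
    (∀ S : {S : Set P // IsCofinal S}, ∃ (R : DirSet.{u}) (h : R → P.sub S.1 S.2),
      DirSet.CofinalMap h ∧ Conv (fun r => x (h r).1) s) → Conv x s
  iter : ∀ {P : DirSet.{u}} {Q : P → DirSet.{u}} {x : ∀ p, Q p → S} {y : P → S} {s : S},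
    (∀ p, Conv (x p) (y p)) → Conv y s → Conv (fun z : P.iter Q => x z.1 (z.2 z.1)) s

namespace ConvClass

variable {S : Type u} (K : ConvClass S)

/-- The topology of a convergence class: a set is open if every net converging to one of its points
is eventually in it. -/
abbrev topology : TopologicalSpace S where
  IsOpen U := ∀ (P : DirSet.{u}) (x : P → S) (s : S), K.Conv x s → s ∈ U →
    ∃ p : P, ∀ q, p ≤ q → x q ∈ U
  isOpen_univ P _ _ _ _ := ⟨Classical.arbitrary P, fun _ _ => trivial⟩
  isOpen_inter U V hU hV P x s hx hs := by
    obtain ⟨p, hp⟩ := hU P x s hx hs.1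
    obtain ⟨q, hq⟩ := hV P x s hx hs.2
    obtain ⟨r, hpr, hqr⟩ := exists_ge_ge p q
    exact ⟨r, fun t ht => ⟨hp t (hpr.trans ht), hq t (hqr.trans ht)⟩⟩
  isOpen_sUnion 𝒰 h𝒰 P x s hx hs := by
    obtain ⟨U, hU, hsU⟩ := hs
    obtain ⟨p, hp⟩ := h𝒰 U hU P x s hx hsU
    exact ⟨p, fun q hq => ⟨U, hU, hp q hq⟩⟩

/-- The set of limits of nets in `E`. -/
def lim (E : Set S) : Set S :=
  {s | ∃ (P : DirSet.{u}) (x : P → S), (∀ p, x p ∈ E) ∧ K.Conv x s}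

theorem subset_lim (E : Set S) : E ⊆ K.lim E := fun s hs =>
  ⟨⟨PUnit⟩, fun _ => s, fun _ => hs, K.const _ s⟩

/-- Limits of limits of nets in `E` are limits of nets in `E`, by the iteration axiom; so `lim` is
the closure operator of the topology. -/
theorem isOpen_compl_lim (E : Set S) : @IsOpen S K.topology (K.lim E)ᶜ := by
  intro P x s hx hs
  by_contra hcon
  push Not at hcon
  apply hs
  -- Along the cofinal set of indices whose terms lie in `lim E`, choose nets in `E` converging to
  -- these terms and iterate.
  have hcof : IsCofinal {q : P | x q ∈ K.lim E} := fun p => by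
    obtain ⟨q, hpq, hq⟩ := hcon p
    exact ⟨q, not_not.1 hq, hpq⟩
  have hsub : K.Conv (fun q : P.sub _ hcof => x q.1) s := by
    refine K.subnet (fun q : P.sub _ hcof => q.1) (fun p => ?_) hx
    obtain ⟨q, hq, hpq⟩ := hcof p
    exact ⟨⟨q, hq⟩, fun q' hq' => hpq.trans hq'⟩
  choose N y hyE hy using fun q : P.sub _ hcof => q.2
  exact ⟨_, _, fun z => hyE _ _, K.iter hy hsub⟩

open ConvSpace in
/-- Kelley's theorem: convergence in the topology of a convergence class is the given one. -/
theorem converges_iff {P : DirSet.{u}} {x : P → S} {s : S} :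
    @Converges P S K.topology x s ↔ K.Conv x s := by
  refine ⟨fun hx => K.loc ?_, fun hx U hU hs => hU P x s hx hs⟩
  rintro ⟨Q, hQ⟩
  have hlim : ∀ p : P, s ∈ K.lim (x '' {q | q ∈ Q ∧ p ≤ q}) := fun p => by
    by_contra hs
    obtain ⟨p', hp'⟩ := hx _ (K.isOpen_compl_lim _) hs
    obtain ⟨r, hpr, hp'r⟩ := exists_ge_ge p p'
    obtain ⟨q, hq, hrq⟩ := hQ r
    exact hp' q (hp'r.trans hrq) (K.subset_lim _ ⟨q, ⟨hq, hpr.trans hrq⟩, rfl⟩)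
  choose N y hyE hy using hlim
  choose k hk hxk using hyE
  -- Iterating the nets `y p` along the constant net `s` yields a net that is eventually beyond
  -- each `p`.
  refine ⟨P.iter N, fun z => ⟨k z.1 (z.2 z.1), (hk _ _).1⟩, fun p => ?_, ?_⟩
  · exact ⟨⟨p.1, fun _ => Classical.arbitrary _⟩, fun z hz => hz.1.trans (hk _ _).2⟩
  · simpa only [hxk] using K.iter hy (K.const P s)

end ConvClass

/-! ### The neighbourhood net of a point -/

/-- The directed set of pairs of an open neighbourhood of `m` and a point of it, ordered by reverse
inclusion of the neighbourhoods. -/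
def nhdDir (M : Type u) [TopologicalSpace M] (m : M) : DirSet.{u} where
  carrier := {z : Set M × M // IsOpen z.1 ∧ m ∈ z.1 ∧ z.2 ∈ z.1}
  preorder := Preorder.lift fun z => OrderDual.toDual z.1.1
  directed := ⟨fun a b =>
    ⟨⟨(a.1.1 ∩ b.1.1, m), a.2.1.inter b.2.1, ⟨a.2.2.1, b.2.2.1⟩, ⟨a.2.2.1, b.2.2.1⟩⟩,
      Set.inter_subset_left (s := a.1.1), Set.inter_subset_right (s := a.1.1)⟩⟩
  nonempty := ⟨⟨(Set.univ, m), isOpen_univ, trivial, trivial⟩⟩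

/-- The net `(U, x) ↦ x`, which converges to `m`. -/
def nhdNet {M : Type u} [TopologicalSpace M] (m : M) (z : nhdDir M m) : M := z.1.2

open ConvSpace

theorem converges_nhdNet {M : Type u} [TopologicalSpace M] (m : M) :
    Converges (nhdNet m) m := fun U hU hm =>
  ⟨⟨(U, m), hU, hm, hm⟩, fun q hq => hq q.2.2.2⟩

theorem Continuous.converges {M N : Type u} [TopologicalSpace M] [TopologicalSpace N] {f : M → N}
    (hf : Continuous f) {P : DirSet.{u}} {x : P → M} {s : M} (hx : Converges x s) :
    Converges (fun p => f (x p)) (f s) :=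
  fun _ hU hs => hx _ (hU.preimage hf) hs

/-- A map is continuous as soon as it preserves the convergence of the neighbourhood nets; there is
only a small set of these. -/
theorem continuous_of_converges_nhdNet {M N : Type u} [TopologicalSpace M] [TopologicalSpace N]
    {f : M → N} (hf : ∀ m, Converges (fun z => f (nhdNet m z)) (f m)) : Continuous f := by
  refine continuous_def.2 fun V hV => isOpen_iff_mem_nhds.2 fun m hm => ?_
  obtain ⟨z, hz⟩ := hf m V hV hm
  refine Filter.mem_of_superset (z.2.1.mem_nhds z.2.2.1) fun y hy => ?_
  exact hz ⟨(z.1.1, y), z.2.1, z.2.2.1, hy⟩ (le_refl z.1.1)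

/-! ### The space of generalized elements of a topological space object -/

namespace TopObj

variable {D : Type w} [Category.{u} D] [HasLimits D] (A : TopObj D)

/-- Convergence of nets of `T`-valued points of a topological space object. -/
def Conv {T : D} {P : DirSet.{u}} (x : P → (T ⟶ A.X)) (s : T ⟶ A.X) : Prop :=
  ∃ c : T ⟶ A.C P, c ≫ A.ι P = netLift x s

variable {A}

theorem comp_netLift {T T' X : D} {P : Type u} (g : T' ⟶ T) (x : P → (T ⟶ X)) (s : T ⟶ X) :
    g ≫ netLift x s = netLift (fun p => g ≫ x p) (g ≫ s) := by
  apply netObj_hom_ext <;> simp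

theorem netLift_eta {T X : D} {P : Type u} (t : T ⟶ netObj X P) :
    netLift (fun p => t ≫ netPt X P p) (t ≫ netLim X P) = t := by
  apply netObj_hom_ext <;> simp

theorem Conv.precomp {T T' : D} (g : T' ⟶ T) {P : DirSet.{u}} {x : P → (T ⟶ A.X)}
    {s : T ⟶ A.X} (h : A.Conv x s) : A.Conv (fun p => g ≫ x p) (g ≫ s) := by
  obtain ⟨c, hc⟩ := h
  exact ⟨g ≫ c, by rw [Category.assoc, hc, comp_netLift]⟩

theorem Conv.map {B : TopObj D} (f : A ⟶ B) {T : D} {P : DirSet.{u}} {x : P → (T ⟶ A.X)}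
    {s : T ⟶ A.X} (h : A.Conv x s) : B.Conv (fun p => x p ≫ f.f) (s ≫ f.f) := by
  obtain ⟨c, hc⟩ := h
  obtain ⟨g, hg⟩ := f.cont P
  refine ⟨c ≫ g, ?_⟩
  rw [Category.assoc, hg, reassoc_of% hc]
  apply netObj_hom_ext <;> simp

theorem conv_ι (P : DirSet.{u}) :
    A.Conv (fun p => A.ι P ≫ netPt A.X P p) (A.ι P ≫ netLim A.X P) :=
  ⟨𝟙 _, by rw [Category.id_comp, netLift_eta]⟩

/-- A morphism of the underlying objects that preserves the convergence of the universal convergent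
nets is a morphism of topological space objects. -/
def homOfConv {B : TopObj D} (f : A.X ⟶ B.X)
    (h : ∀ P : DirSet.{u}, B.Conv (fun p => (A.ι P ≫ netPt A.X P p) ≫ f)
      ((A.ι P ≫ netLim A.X P) ≫ f)) : A ⟶ B :=
  ⟨f, fun P => by
    obtain ⟨c, hc⟩ := h P
    refine ⟨c, hc.trans ?_⟩
    apply netObj_hom_ext <;> simp⟩

theorem mapObj_ι_netPt {D' : Type w'} [Category.{u} D'] [HasLimits D'] (G : D ⥤ D')
    [PreservesLimitsOfSize.{u, u} G] (A : TopObj D) (P : DirSet.{u}) (p : P) :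
    (mapObj G A).ι P ≫ netPt (mapObj G A).X P p = G.map (A.ι P ≫ netPt A.X P p) := by
  change (G.map (A.ι P) ≫ netComparison G A.X P) ≫ netPt (G.obj A.X) P p = _
  rw [Category.assoc, netLift_netPt, ← G.map_comp]

theorem mapObj_ι_netLim {D' : Type w'} [Category.{u} D'] [HasLimits D'] (G : D ⥤ D')
    [PreservesLimitsOfSize.{u, u} G] (A : TopObj D) (P : DirSet.{u}) :
    (mapObj G A).ι P ≫ netLim (mapObj G A).X P = G.map (A.ι P ≫ netLim A.X P) := by
  change (G.map (A.ι P) ≫ netComparison G A.X P) ≫ netLim (G.obj A.X) P = _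
  rw [Category.assoc, netLift_netLim, ← G.map_comp]

variable (A)

/-- The four axioms of a topological space object, read on `T`-valued points. -/
def convClass (T : D) : ConvClass (T ⟶ A.X) where
  Conv x s := A.Conv x s
  const P s := by
    obtain ⟨c, hc⟩ := A.const P
    exact ⟨s ≫ c, by rw [Category.assoc, hc, comp_netLift]; simp⟩
  subnet {P Q} h hh x s := by
    rintro ⟨c, hc⟩
    obtain ⟨d, hd⟩ := A.subnet P Q h hh
    refine ⟨c ≫ d, ?_⟩
    rw [Category.assoc, hd, reassoc_of% hc]
    apply netObj_hom_ext <;> simp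
  loc {P x s} H := by
    choose R h hh c hc using H
    obtain ⟨d, hd⟩ := A.loc P R h hh
    refine ⟨pullback.lift (Pi.lift c) (netLift x s) ?_ ≫ d, ?_⟩
    · apply Limits.Pi.hom_ext
      intro S
      simp only [Category.assoc, Limits.Pi.map_π, Pi.lift_π, Pi.lift_π_assoc, hc]
      apply netObj_hom_ext <;> simp
    · rw [Category.assoc, hd, pullback.lift_snd]
  iter {P Q x y s} hx hy := by
    choose c hc using hx
    obtain ⟨b, hb⟩ := hy
    obtain ⟨d, hd⟩ := A.iter P Q
    refine ⟨pullback.lift (Pi.lift c) b ?_ ≫ d, ?_⟩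
    · apply Limits.Pi.hom_ext
      intro p
      simp only [Category.assoc, Limits.Pi.map_π, Pi.lift_π_assoc, reassoc_of% hb, reassoc_of% hc,
        netLift_netLim]
      exact (netLift_netPt y s p).symm
    · rw [Category.assoc, hd, comp_netLift]
      simp only [pullback.lift_fst_assoc, pullback.lift_snd_assoc, Pi.lift_π_assoc,
        reassoc_of% hc, reassoc_of% hb, netLift_netLim, netLift_netPt]

/-- The set of `T`-valued points of a topological space object, as a type synonym that carries the
topology of net convergence. -/
def Points (T : D) : Type u := T ⟶ A.X

instance (T : D) : TopologicalSpace (A.Points T) := (A.convClass T).topology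

variable {A}

theorem converges_iff {T : D} {P : DirSet.{u}} {x : P → A.Points T} {s : A.Points T} :
    Converges x s ↔ A.Conv (T := T) x s :=
  (A.convClass T).converges_iff

/-- Continuity of a map into the space of `T`-valued points is a condition on a small set of nets. -/
theorem continuous_points_iff {M : Type u} [TopologicalSpace M] {T : D} {φ : M → A.Points T} :
    Continuous φ ↔ ∀ m, A.Conv (T := T) (fun z => φ (nhdNet m z)) (φ m) :=
  ⟨fun h m => converges_iff.1 (h.converges (converges_nhdNet m)),
    fun h => continuous_of_converges_nhdNet fun m => converges_iff.2 (h m)⟩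

theorem continuous_precomp {T T' : D} (g : T' ⟶ T) :
    Continuous (X := A.Points T) (Y := A.Points T') fun t => g ≫ (t : T ⟶ A.X) :=
  continuous_points_iff.2 fun t =>
    Conv.precomp g (continuous_points_iff.1 (continuous_id (X := A.Points T)) t)

theorem continuous_postcomp {B : TopObj D} (f : A ⟶ B) (T : D) :
    Continuous (X := A.Points T) (Y := B.Points T) fun t => (t : T ⟶ A.X) ≫ f.f :=
  continuous_points_iff.2 fun t =>
    Conv.map f (continuous_points_iff.1 (continuous_id (X := A.Points T)) t)

variable (A)

/-- The functor sending an object `T` to the space of `T`-valued points. -/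
def points : Dᵒᵖ ⥤ TopCat.{u} where
  obj T := TopCat.of (A.Points T.unop)
  map g := TopCat.ofHom ⟨_, continuous_precomp g.unop⟩
  map_id T := by
    ext t
    exact Category.id_comp (X := T.unop) (Y := A.X) _
  map_comp {T T' T''} g h := by
    ext t
    exact Category.assoc (W := T''.unop) (Z := A.X) h.unop g.unop t

/-- The object of continuous maps from a space `M` to a topological space object: the subobject of
`X ^ M` cut out by the condition that the neighbourhood nets of `M` go to convergent nets. -/
abbrev pow (M : TopCat.{u}) : D :=
  pullback (Limits.Pi.map fun m : M => A.ι (nhdDir M m))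
    (Pi.lift fun m : M => netLift (fun z => Pi.π (fun _ : M => A.X) (nhdNet m z))
      (Pi.π (fun _ : M => A.X) m))

/-- Evaluation at a point `m`. -/
def powEv (M : TopCat.{u}) (m : M) : A.pow M ⟶ A.X :=
  pullback.snd _ _ ≫ Pi.π (fun _ : M => A.X) m

theorem continuous_powEv (M : TopCat.{u}) {T : D} (g : T ⟶ A.pow M) :
    Continuous (Y := A.Points T) fun m : M => g ≫ A.powEv M m := by
  refine continuous_points_iff.2 fun m => Conv.precomp g ⟨pullback.fst _ _ ≫ Pi.π (fun m : M => A.C (nhdDir M m)) m, ?_⟩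
  have := pullback.condition (f := Limits.Pi.map fun m : M => A.ι (nhdDir M m))
    (g := Pi.lift fun m : M => netLift (fun z => Pi.π (fun _ : M => A.X) (nhdNet m z))
      (Pi.π (fun _ : M => A.X) m)) =≫ Pi.π _ m
  rw [Category.assoc, Category.assoc, Limits.Pi.map_π, Pi.lift_π, comp_netLift] at this
  rw [Category.assoc, this]
  rfl

/-- `A.pow M` represents the functor sending `T` to the set of continuous maps from `M` to the space
of `T`-valued points of `A`. -/
def powEquiv (M : TopCat.{u}) (T : D) : (T ⟶ A.pow M) ≃ (M ⟶ A.points.obj (op T)) :=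
  Equiv.ofBijective (fun g => TopCat.ofHom ⟨_, A.continuous_powEv M g⟩) <| by
    constructor
    · intro g g' h
      rw [← cancel_mono (pullback.snd _ _)]
      apply Limits.Pi.hom_ext
      intro m
      have : g ≫ A.powEv M m = g' ≫ A.powEv M m := ConcreteCategory.congr_hom h m
      simpa [powEv] using this
    · intro φ
      have hφ := continuous_points_iff.1 φ.hom.continuous
      choose c hc using hφ
      refine ⟨pullback.lift (Pi.lift c) (Pi.lift fun m => φ m) ?_, ?_⟩
      · apply Limits.Pi.hom_ext
        intro m
        simp only [Category.assoc, Limits.Pi.map_π, Pi.lift_π, Pi.lift_π_assoc, hc, comp_netLift]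
        congr 1
        · funext z
          exact (Pi.lift_π (fun m : M => (φ m : T ⟶ A.X)) _).symm
        · exact (Pi.lift_π (fun m : M => (φ m : T ⟶ A.X)) _).symm
      · ext m
        change pullback.lift _ _ _ ≫ A.powEv M m = φ m
        rw [powEv, pullback.lift_snd_assoc]
        exact Pi.lift_π (fun m : M => (φ m : T ⟶ A.X)) _

theorem powEquiv_apply (M : TopCat.{u}) {T : D} (g : T ⟶ A.pow M) (m : M) :
    A.powEquiv M T g m = g ≫ A.powEv M m := rfl

end TopObj

open PointCoTop

/-! ### Spaces as colimits of points and convergent nets -/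

section Coproducts

variable {A : Type w} [Category.{u} A] [HasColimits A] {C : Type w'} [Category.{u} C]
  [HasColimits C] (F : A ⥤ C) [PreservesColimitsOfSize.{u, u} F]

theorem exists_map_sigma_desc {J : Type u} (f : J → A) {Y : C} (a : ∀ j, F.obj (f j) ⟶ Y) :
    ∃ l : F.obj (∐ f) ⟶ Y, ∀ j, F.map (Sigma.ι f j) ≫ l = a j :=
  ⟨inv (sigmaComparison F f) ≫ Sigma.desc a, fun j => by
    rw [← ι_comp_sigmaComparison_assoc, IsIso.hom_inv_id_assoc, Sigma.ι_desc]⟩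

theorem map_sigma_hom_ext {J : Type u} (f : J → A) {Y : C} {a b : F.obj (∐ f) ⟶ Y}
    (h : ∀ j, F.map (Sigma.ι f j) ≫ a = F.map (Sigma.ι f j) ≫ b) : a = b := by
  rw [← cancel_epi (sigmaComparison F f)]
  apply Sigma.hom_ext
  intro j
  simpa using h j

end Coproducts

namespace PointCoTop

@[simp]
theorem ptHom_comp {M N : TopCat.{u}} (m : M) (f : M ⟶ N) : ptHom m ≫ f = ptHom (f m) := rfl

variable (M : TopCat.{u})

/-- The continuous map `P ∪ {∞} ⟶ M` given by the neighbourhood net of a point. -/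
def nhdHom (m : M) : TopCat.of (ConvSpace (nhdDir M m)) ⟶ M :=
  TopCat.ofHom ⟨extend (nhdNet m) m, continuous_extend_iff.2 (converges_nhdNet m)⟩

/-- The coproduct of the points of `M`. -/
abbrev sigmaPts : TopCat.{u} := ∐ fun _ : M => point.{u}

/-- The coproduct of the convergent nets `P ∪ {∞}` for the neighbourhood nets of `M`. -/
abbrev sigmaNets : TopCat.{u} := ∐ fun m : M => TopCat.of (ConvSpace (nhdDir M m))

/-- The coproduct of the points of the convergent nets `P ∪ {∞}` for the neighbourhood nets of
`M`. -/
abbrev sigmaNetPts : TopCat.{u} := ∐ fun _ : (Σ m : M, ConvSpace (nhdDir M m)) => point.{u}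

/-- The map that sends the summand of a term of a neighbourhood net to the summand of the
corresponding point of `M`. -/
abbrev sigmaNetPtsToPts : sigmaNetPts M ⟶ sigmaPts M :=
  Sigma.desc fun z => Sigma.ι (fun _ : M => point.{u}) (nhdHom M z.1 z.2)

/-- The map that sends each summand of a term of a neighbourhood net to that term. -/
abbrev sigmaNetPtsToNets : sigmaNetPts M ⟶ sigmaNets M :=
  Sigma.desc fun z => ptHom (M := TopCat.of (ConvSpace (nhdDir M z.1))) z.2 ≫
    Sigma.ι (fun m : M => TopCat.of (ConvSpace (nhdDir M m))) z.1

instance : Epi (Sigma.desc ptHom : sigmaPts M ⟶ M) := by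
  refine (TopCat.epi_iff_surjective _).2 fun m => ⟨Sigma.ι (fun _ : M => point.{u}) m ⟨⟩, ?_⟩
  exact ConcreteCategory.congr_hom (Sigma.ι_desc (ptHom (M := M)) m) PUnit.unit

/-- A space is obtained from the discrete space of its points by prescribing the convergence of the
neighbourhood nets. -/
theorem isPushout_nhdHom : IsPushout (sigmaNetPtsToPts M) (sigmaNetPtsToNets M)
    (Sigma.desc ptHom : sigmaPts M ⟶ M) (Sigma.desc (nhdHom M)) where
  w := by
    apply Sigma.hom_ext
    rintro ⟨m, z⟩
    simp
  isColimit' := ⟨PushoutCocone.isColimitAux' _ fun s => by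
    have key : ∀ (m : M) (z : ConvSpace (nhdDir M m)),
        s.inl (Sigma.ι (fun _ : M => point.{u}) (nhdHom M m z) PUnit.unit) =
          (Sigma.ι (fun m : M => TopCat.of (ConvSpace (nhdDir M m))) m ≫ s.inr) z := by
      intro m z
      have h := Sigma.ι (fun _ : (Σ m : M, ConvSpace (nhdDir M m)) => point.{u}) ⟨m, z⟩ ≫=
        s.condition
      rw [Sigma.ι_desc_assoc, Sigma.ι_desc_assoc, Category.assoc] at h
      exact ConcreteCategory.congr_hom h PUnit.unit
    have hinl : s.inl = Sigma.desc ptHom ≫ TopCat.ofHom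
        ⟨fun m : M => s.inl (Sigma.ι (fun _ : M => point.{u}) m PUnit.unit), by
          refine continuous_of_converges_nhdNet fun m => ?_
          have := converges_of_continuous
            (Sigma.ι (fun m : M => TopCat.of (ConvSpace (nhdDir M m))) m ≫ s.inr).hom.continuous
          exact (congrArg₂ Converges (funext fun z => key m (pt z)) (key m infty)).mpr this⟩ := by
      apply Sigma.hom_ext
      intro m
      rw [Sigma.ι_desc_assoc]
      ext ⟨⟩
      rfl
    refine ⟨_, hinl.symm, ?_, ?_⟩
    · apply Sigma.hom_ext
      intro m
      erw [Sigma.ι_desc_assoc]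
      ext z
      exact key m z
    · intro l hl _
      exact (cancel_epi (Sigma.desc ptHom : sigmaPts M ⟶ M)).1 (hl.trans hinl)⟩

end PointCoTop

/-! ### Cocontinuous functors on the category of topological spaces -/

namespace CoTop

variable {C : Type w} [Category.{u} C] [HasColimits C] (F : CocontFunctor TopCat.{u} C)

instance preservesColimits_obj : PreservesColimitsOfSize.{u, u} F.obj := F.property

/-- The value at the point of a cocontinuous functor, as a topological space object in the opposite
category. -/
abbrev pointImage : TopObj Cᵒᵖ := TopObj.mapObj F.obj.op pointCoTop.unop

theorem pointImage_ι_netPt (P : DirSet.{u}) (p : P) :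
    (pointImage F).ι P ≫ netPt (pointImage F).X P p =
      (F.obj.map (ptHom (M := TopCat.of (ConvSpace P)) (pt p))).op :=
  (TopObj.mapObj_ι_netPt F.obj.op pointCoTop.unop P p).trans
    (congrArg F.obj.op.map (netLift_netPt _ _ p))

theorem pointImage_ι_netLim (P : DirSet.{u}) :
    (pointImage F).ι P ≫ netLim (pointImage F).X P =
      (F.obj.map (ptHom (M := TopCat.of (ConvSpace P)) infty)).op :=
  (TopObj.mapObj_ι_netLim F.obj.op pointCoTop.unop P).trans
    (congrArg F.obj.op.map (netLift_netLim _ _))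

/-- A net of morphisms `F(1) ⟶ T` converges if and only if it extends to a morphism from
`F(P ∪ {∞})`. -/
theorem conv_pointImage {T : Cᵒᵖ} {P : DirSet.{u}} {x : P → (T ⟶ (pointImage F).X)}
    {s : T ⟶ (pointImage F).X} :
    (pointImage F).Conv x s ↔ ∃ c : F.obj.obj (TopCat.of (ConvSpace P)) ⟶ T.unop,
      (∀ p, F.obj.map (ptHom (M := TopCat.of (ConvSpace P)) (pt p)) ≫ c = (x p).unop) ∧
        F.obj.map (ptHom (M := TopCat.of (ConvSpace P)) infty) ≫ c = s.unop := by
  constructor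
  · rintro ⟨c, hc⟩
    refine ⟨c.unop, fun p => ?_, ?_⟩
    · apply Quiver.Hom.op_inj
      have := hc =≫ netPt _ P p
      rwa [Category.assoc, pointImage_ι_netPt, netLift_netPt] at this
    · apply Quiver.Hom.op_inj
      have := hc =≫ netLim _ P
      rwa [Category.assoc, pointImage_ι_netLim, netLift_netLim] at this
  · rintro ⟨c, hc, hc'⟩
    let d : T ⟶ (pointImage F).C P := c.op
    refine ⟨d, ?_⟩
    apply netObj_hom_ext
    · intro p
      rw [Category.assoc, pointImage_ι_netPt, netLift_netPt]
      exact Quiver.Hom.unop_inj (hc p)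
    · rw [Category.assoc, pointImage_ι_netLim, netLift_netLim]
      exact Quiver.Hom.unop_inj hc'

/-- For a cocontinuous functor `F`, the morphisms `F(1) ⟶ Y` obtained by restricting a morphism
`F(M) ⟶ Y` to the points of `M` depend continuously on the point. -/
theorem continuous_map_ptHom (M : TopCat.{u}) {Y : C} (g : F.obj.obj M ⟶ Y) :
    Continuous (Y := (pointImage F).Points (op Y))
      fun m : M => ((F.obj.map (ptHom m) ≫ g).op : op Y ⟶ (pointImage F).X) := by
  refine TopObj.continuous_points_iff.2 fun m => (conv_pointImage F).2
    ⟨F.obj.map (nhdHom M m) ≫ g, fun z => ?_, ?_⟩ <;>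
  · rw [← Functor.map_comp_assoc, ptHom_comp]
    rfl

theorem map_ptHom_hom_ext {M : TopCat.{u}} {Y : C} {g g' : F.obj.obj M ⟶ Y}
    (h : ∀ m : M, F.obj.map (ptHom m) ≫ g = F.obj.map (ptHom m) ≫ g') : g = g' := by
  rw [← cancel_epi (F.obj.map (Sigma.desc ptHom : sigmaPts M ⟶ M))]
  apply map_sigma_hom_ext
  intro m
  simp only [← Functor.map_comp_assoc, Sigma.ι_desc, h]

/-- For a cocontinuous functor `F`, a family of morphisms `F(1) ⟶ Y` indexed by a space `M` comes
from a morphism `F(M) ⟶ Y` if it depends continuously on the point of `M`. -/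
theorem exists_map_ptHom_comp {M : TopCat.{u}} {Y : C} (φ : M → (F.obj.obj point ⟶ Y))
    (hφ : Continuous (Y := (pointImage F).Points (op Y)) fun m => (φ m).op) :
    ∃ g : F.obj.obj M ⟶ Y, ∀ m, F.obj.map (ptHom m) ≫ g = φ m := by
  obtain ⟨a, ha⟩ := exists_map_sigma_desc F.obj (fun _ : M => point.{u}) φ
  choose c hc hc' using fun m => (conv_pointImage F).1 (TopObj.continuous_points_iff.1 hφ m)
  obtain ⟨b, hb⟩ := exists_map_sigma_desc F.obj
    (fun m : M => TopCat.of (ConvSpace (nhdDir M m))) c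
  have hw : F.obj.map (sigmaNetPtsToPts M) ≫ a = F.obj.map (sigmaNetPtsToNets M) ≫ b := by
    apply map_sigma_hom_ext
    rintro ⟨m, z⟩
    simp only [← Functor.map_comp_assoc, Sigma.ι_desc]
    rw [ha, Functor.map_comp_assoc, hb]
    rcases z with _ | z
    · exact (hc' m).symm
    · exact (hc m z).symm
  refine ⟨((isPushout_nhdHom M).map F.obj).desc a b hw, fun m => ?_⟩
  have := F.obj.map (Sigma.ι (fun _ : M => point.{u}) m) ≫=
    ((isPushout_nhdHom M).map F.obj).inl_desc a b hw
  rwa [ha, ← Functor.map_comp_assoc, Sigma.ι_desc] at this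

instance : (evalAt (C := C) pointCoTop.{u}).Faithful where
  map_injective {F G α β} h := by
    have h₁ : α.hom.app point = β.hom.app point :=
      Quiver.Hom.op_inj (congrArg (fun k => k.unop.f) h)
    apply ObjectProperty.hom_ext
    ext M
    apply map_ptHom_hom_ext
    intro m
    rw [α.hom.naturality, β.hom.naturality, h₁]

/-- A morphism `F(1) ⟶ G(1)` of cotopological space objects extends to `F(M) ⟶ G(M)` because the
composites `F(1) ⟶ G(1) ⟶ G(M)` depend continuously on the point of `M`. -/
instance : (evalAt (C := C) pointCoTop.{u}).Full where
  map_surjective {F G} f := by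
    let f' : pointImage G ⟶ pointImage F := f.unop
    let f₁ : F.obj.obj point ⟶ G.obj.obj point := f'.f.unop
    have hcont (M : TopCat.{u}) : Continuous (Y := (pointImage F).Points (op (G.obj.obj M)))
        fun m : M => (f₁ ≫ G.obj.map (ptHom m)).op := by
      have := (TopObj.continuous_postcomp f' _).comp (continuous_map_ptHom G M (𝟙 _))
      simp only [Category.comp_id] at this
      exact this
    choose α hα using fun M : TopCat.{u} =>
      exists_map_ptHom_comp F (M := M) (Y := G.obj.obj M)
        (fun m => f₁ ≫ G.obj.map (ptHom m)) (hcont M)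
    refine ⟨ObjectProperty.homMk ⟨α, fun M N g => ?_⟩, ?_⟩
    · apply map_ptHom_hom_ext
      intro m
      rw [← Functor.map_comp_assoc, reassoc_of% hα, ptHom_comp, hα, ← Functor.map_comp, ptHom_comp]
    · apply Quiver.Hom.unop_inj
      apply TopObj.hom_ext
      apply Quiver.Hom.unop_inj
      have h := hα point PUnit.unit
      have hid : ptHom (M := point.{u}) PUnit.unit = 𝟙 _ := rfl
      rw [hid, F.obj.map_id, G.obj.map_id, Category.id_comp, Category.comp_id] at h
      exact h

/-! ### The cocontinuous functor of a cotopological space object -/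

section Tensor

variable (A : TopObj Cᵒᵖ)

/-- The functor sending an object `Y` of `C` to the space of morphisms to `Y` from a cotopological
space object. -/
abbrev homSpace : C ⥤ TopCat.{u} := opOp C ⋙ A.points

/-- The bijection that exhibits the object of continuous maps from `M` to `A`, as an object of `C`,
as the value at `M` of a left adjoint. -/
def tensorEquiv (M : TopCat.{u}) (Y : C) : ((A.pow M).unop ⟶ Y) ≃ (M ⟶ (homSpace A).obj Y) :=
  Quiver.Hom.opEquiv.trans (A.powEquiv M (op Y))

theorem tensorEquiv_naturality (M : TopCat.{u}) (Y Y' : C) (g : Y ⟶ Y')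
    (h : (A.pow M).unop ⟶ Y) :
    tensorEquiv A M Y' (h ≫ g) = tensorEquiv A M Y h ≫ (homSpace A).map g := by
  ext m
  exact Category.assoc (W := op Y') (Z := A.X) g.op h.op (A.powEv M m)

/-- The left adjoint of the functor of points. -/
def tensor : TopCat.{u} ⥤ C := 
  Adjunction.leftAdjointOfEquiv (tensorEquiv A) (tensorEquiv_naturality A)

/-- The adjunction between the functors `tensor` and `homSpace`. -/
def tensorAdj : tensor A ⊣ homSpace A := Adjunction.adjunctionOfEquivLeft _ (tensorEquiv_naturality A)

/-- The left adjoint of the functor of points, as a cocontinuous functor. -/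
def tensorCocont : CocontFunctor TopCat.{u} C :=
  ⟨tensor A, (tensorAdj A).leftAdjoint_preservesColimits⟩

/-- The universal `A`-valued point on `M`. -/
def tensorPt {M : TopCat.{u}} (m : M) : op ((tensor A).obj M) ⟶ A.X := (tensorAdj A).unit.app M m

theorem homEquiv_apply {M : TopCat.{u}} {Y : C} (g : (tensor A).obj M ⟶ Y) (m : M) :
    (tensorAdj A).homEquiv M Y g m = (g.op ≫ tensorPt A m : op Y ⟶ A.X) := by
  rw [Adjunction.homEquiv_unit]
  rfl

theorem exists_tensorPt {M : TopCat.{u}} {Y : C} (φ : M → A.Points (op Y)) (hφ : Continuous φ) :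
    ∃ g : (tensor A).obj M ⟶ Y, ∀ m, g.op ≫ tensorPt A m = φ m := by
  obtain ⟨g, hg⟩ := ((tensorAdj A).homEquiv M Y).surjective (TopCat.ofHom ⟨φ, hφ⟩)
  refine ⟨g, fun m => ?_⟩
  rw [← homEquiv_apply, hg]
  rfl

theorem tensorPt_hom_ext {M : TopCat.{u}} {Y : C} {g g' : (tensor A).obj M ⟶ Y}
    (h : ∀ m, g.op ≫ tensorPt A m = g'.op ≫ tensorPt A m) : g = g' := by
  apply ((tensorAdj A).homEquiv M Y).injective
  ext m
  rw [homEquiv_apply, homEquiv_apply, h]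

theorem map_comp_tensorPt {M N : TopCat.{u}} (f : M ⟶ N) (m : M) :
    ((tensor A).map f).op ≫ tensorPt A m = tensorPt A (f m) :=
  (ConcreteCategory.congr_hom ((tensorAdj A).unit.naturality f) m).symm

theorem continuous_tensorPt (M : TopCat.{u}) :
    Continuous (Y := A.Points (op ((tensor A).obj M))) fun m : M => tensorPt A m :=
  ((tensorAdj A).unit.app M).hom.continuous

/-- The value at the point of the left adjoint of the functor of points is the given topological
space object. -/
def tensorPointIso : pointImage (tensorCocont A) ≅ A := by
  have h₁ := exists_tensorPt A (M := point) (Y := A.X.unop) (fun _ => 𝟙 A.X) continuous_const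
  let g := h₁.choose
  have hg : g.op ≫ tensorPt A (M := point) PUnit.unit = 𝟙 A.X := h₁.choose_spec _
  have hg' : tensorPt A (M := point) PUnit.unit ≫ g.op = 𝟙 _ := by
    apply Quiver.Hom.unop_inj
    apply tensorPt_hom_ext
    rintro ⟨⟩
    change (tensorPt A (M := point) PUnit.unit ≫ g.op) ≫ _ = 𝟙 _ ≫ _
    rw [Category.assoc, hg, Category.comp_id, Category.id_comp]
  refine ⟨TopObj.homOfConv (tensorPt A (M := point) PUnit.unit) fun P => ?_,
    TopObj.homOfConv g.op fun P => (conv_pointImage _).2 ?_,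
    TopObj.hom_ext hg', TopObj.hom_ext hg⟩
  · simp only [pointImage_ι_netPt, pointImage_ι_netLim]
    have h (z : ConvSpace P) :=
      map_comp_tensorPt A (ptHom (M := TopCat.of (ConvSpace P)) z) PUnit.unit
    exact (congrArg₂ A.Conv (funext fun p => h (pt p)) (h infty)).mpr (TopObj.converges_iff.1
      (converges_of_continuous (continuous_tensorPt A (TopCat.of (ConvSpace P)))))
  · obtain ⟨d, hd⟩ := exists_tensorPt A (M := TopCat.of (ConvSpace P)) (Y := (A.C P).unop)
      (extend (fun p => A.ι P ≫ netPt A.X P p) (A.ι P ≫ netLim A.X P))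
      (continuous_extend_iff.2 (TopObj.converges_iff.2 (TopObj.conv_ι P)))
    have key (z : ConvSpace P) (t : A.C P ⟶ A.X)
        (ht : d.op ≫ tensorPt A (M := TopCat.of (ConvSpace P)) z = t) :
        (tensor A).map (ptHom (M := TopCat.of (ConvSpace P)) z) ≫ d = (t ≫ g.op).unop := by
      apply Quiver.Hom.op_inj
      have hz : ((tensor A).map (ptHom (M := TopCat.of (ConvSpace P)) z)).op ≫
          tensorPt A (M := point) PUnit.unit = tensorPt A (M := TopCat.of (ConvSpace P)) z :=
        map_comp_tensorPt A _ _
      rw [← ht, ← hz, Category.assoc, Category.assoc, hg', Category.comp_id]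
      rfl
    exact ⟨d, fun p => key _ _ (hd (pt p)), key _ _ (hd infty)⟩

end Tensor

instance : (evalAt (C := C) pointCoTop.{u}).EssSurj where
  mem_essImage K := ⟨tensorCocont K.unop, ⟨(tensorPointIso K.unop).symm.op⟩⟩

end CoTop

end

theorem theorem8p4 (C : Type w) [Category.{u} C] [HasColimits C] :
    ∃ e : CocontFunctor TopCat.{u} C ≌ CoTop C, e.functor = CoTop.evalAt pointCoTop := by
  have : (CoTop.evalAt (C := C) pointCoTop.{u}).IsEquivalence := { }
  exact ⟨(CoTop.evalAt pointCoTop).asEquivalence, rfl⟩
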